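/- Let $L$ be a (one-sorted) first-order language, let $T$ be a complete $L$-theory, and let $\mathfrak{C}$ be a monster model of $T$, i.e. a model that is $\kappa$-saturated and strongly $\kappa$-homogeneous for some cardinal $\kappa>|L|+\aleph_0$. For $n\in\mathbb{N}$ and $x=(x_0,\dots,x_{n-1})$ let $S_x(\mathfrak{C})$ be the compact Hausdorff space of complete types over $\mathfrak{C}$ in the variables $x$, on which $\operatorname{Aut}(\mathfrak{C})$ acts by $\sigma\cdot p=\{\varphi(x,\sigma(a)) : \varphi(x,a)\in p\}$. Call $T$ stable if there are no $L$-formula $\varphi(x,y)$ ($x,y$ finite tuples of variables), model $N\models T$ and sequences of tuples $(b_i)_{i<\omega},(a_j)_{j<\omega}$ in $N$ such that $N\models\varphi(b_i,a_j)\iff i\le j$ for all $i,j<\omega$. For a group $G$ acting by homeomorphisms on a compact Hausdorff space $X$, the Ellis semigroup $E(X,G)$ is the closure of $\{x\mapsto g\cdot x : g\in G\}$ in $X^X$ with the product topology. For $f:X\to X$, a neighbourhood $W$ of the diagonal in $X\times X$ and a closed set $Y\subseteq X$, let $(Y)'_{f,W}$ be the set of those $y\in Y$ such that every neighbourhood $V$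 of $y$, open in $Y$, contains $v_1,v_2$ with $(f(v_1),f(v_2))\notin W$. Put $(X)^0_{f,W}=X$, $(X)^{\alpha+1}_{f,W}=\big((X)^{\alpha}_{f,W}\big)'_{f,W}$, and $(X)^{\gamma}_{f,W}=\bigcap_{\alpha<\gamma}(X)^{\alpha}_{f,W}$ for limit ordinals $\gamma$. Let $\beta(f,W)=\sup\{\alpha : (X)^\alpha_{f,W}\neq\emptyset\}$, with $\beta(f,W)=\infty$ if $(X)^\alpha_{f,W}\ne\emptyset$ for all ordinals $\alpha$, let $\beta(f)=\sup_W\beta(f,W)$, and let $\beta(X,G)=\sup\{\beta(\eta) : \eta\in E(X,G)\}$. Then: 1. $T$ is stable if and only if $\beta(S_x(\mathfrak{C}),\operatorname{Aut}(\mathfrak{C}))=0$ for every finite tuple of variables $x$. 2. $T$ is stable if and only if, for every finite tuple of variables $x$, every element of the Ellis semigroup $E(S_x(\mathfrak{C}),\operatorname{Aut}(\mathfrak{C}))$ is continuous. -/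

import Mathlib

universe u v w

open FirstOrder Cardinal Topology

/-! ### Dynamical systems: the Ellis semigroup and the beta-rank -/

namespace BetaRank

variable {X : Type u} [TopologicalSpace X]

/-- The `(f, W)`-derivative of `Y`: the points `y` of `Y` at which the restriction of `f` to `Y`
`W`-oscillates. The open neighbourhoods of `y` in `Y` are the sets `V ∩ Y`, `V` open in `X`. -/
def oscDeriv (f : X → X) (W : Set (X × X)) (Y : Set X) : Set X :=
  {y | y ∈ Y ∧ ∀ V : Set X, IsOpen V → y ∈ V →
    ∃ v₁ ∈ V ∩ Y, ∃ v₂ ∈ V ∩ Y, (f v₁, f v₂) ∉ W}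

/-- The iterated derivative of `Y` of order `α`, by transfinite recursion: apply the derivative at
successor stages and intersect all the earlier sets at limit stages. -/
noncomputable def iterDeriv (f : X → X) (W : Set (X × X)) (Y : Set X) (α : Ordinal.{u}) : Set X :=
  Ordinal.limitRecOn (motive := fun _ => Set X) α Y
    (fun _ S => oscDeriv f W S)
    (fun γ _ S => ⋂ (δ : Ordinal.{u}) (h : δ < γ), S δ h)

/-- The rank of the pair `(f, W)`: the supremum of the ordinals `α` for which the iterated
derivative of `X` of order `α` is nonempty; it is `⊤` if there is no bound on these `α`. -/
noncomputable def rankAt (f : X → X) (W : Set (X × X)) : WithTop Ordinal.{u} :=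
  sSup ((fun α : Ordinal.{u} => (α : WithTop Ordinal.{u})) ''
    {α | (iterDeriv f W Set.univ α).Nonempty})

/-- The rank of `f`: the supremum of the ranks of `(f, W)` over all neighbourhoods `W` of the
diagonal in `X × X`, which for compact Hausdorff `X` form the unique compatible uniformity. -/
noncomputable def rankFun (f : X → X) : WithTop Ordinal.{u} :=
  ⨆ W ∈ 𝓝ˢ (Set.diagonal X), rankAt f W

variable (X) (G : Type v) [Group G] [MulAction G X]

/-- The Ellis semigroup: the closure, for pointwise convergence, of the set of translations. -/
def ellisSemigroup : Set (X → X) :=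
  closure (Set.range fun (g : G) (x : X) => g • x)

/-- The rank of the whole system. -/
noncomputable def rank : WithTop Ordinal.{u} :=
  ⨆ η ∈ ellisSemigroup X G, rankFun η

end BetaRank

/-! ### Model theory -/

namespace ModelTh

variable {L : FirstOrder.Language.{u, v}}

/-- The formula `φ(x, y)` has the order property in `M`. -/
def HasOrderProperty {n m : ℕ} (φ : L.Formula (Fin n ⊕ Fin m)) (M : Type w) [L.Structure M] :
    Prop :=
  ∃ (b : ℕ → Fin n → M) (a : ℕ → Fin m → M),
    ∀ i j : ℕ, φ.Realize (Sum.elim (b i) (a j)) ↔ i ≤ j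

/-- `T` is stable: no formula `φ(x, y)` (in finite tuples of variables) has the order property in a
model of `T`. By the downward Löwenheim-Skolem theorem, models in the universe of the language
suffice. -/
def IsStable (T : L.Theory) : Prop :=
  ∀ (n m : ℕ) (φ : L.Formula (Fin n ⊕ Fin m)) (N : T.ModelType.{u, v, max u v}),
    ¬ HasOrderProperty φ N

variable (L) (M : Type w) [L.Structure M]

/-- `M` is `κ`-saturated: every set of formulas in one variable with parameters from a set `A` of
fewer than `κ` elements that is finitely satisfiable in `M` is realized in `M`. -/
def IsSaturated (κ : Cardinal.{w}) : Prop :=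
  ∀ A : Set M, #A < κ → ∀ p : Set (L.Formula (A ⊕ Fin 1)),
    (∀ s : Finset (L.Formula (A ⊕ Fin 1)), (s : Set (L.Formula (A ⊕ Fin 1))) ⊆ p →
      ∃ b : M, ∀ φ ∈ s, φ.Realize (Sum.elim (fun a : A => (a : M)) fun _ => b)) →
    ∃ b : M, ∀ φ ∈ p, φ.Realize (Sum.elim (fun a : A => (a : M)) fun _ => b)

/-- `M` is strongly `κ`-homogeneous: every partial elementary map defined on a set of fewer than
`κ` elements extends to an automorphism. -/
def IsStronglyHomogeneous (κ : Cardinal.{w}) : Prop :=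
  ∀ A : Set M, #A < κ → ∀ f : A → M,
    (∀ φ : L.Formula A, φ.Realize f ↔ φ.Realize fun a : A => (a : M)) →
    ∃ σ : M ≃[L] M, ∀ a : A, σ a = f a

/-- `M` is a monster structure: `κ`-saturated and strongly `κ`-homogeneous for some cardinal `κ`
greater than the number of `L`-formulas, which is `max ℵ₀ L.card`. -/
def IsMonster : Prop :=
  ∃ κ : Cardinal.{w},
    Cardinal.lift.{w} (max ℵ₀ L.card) < Cardinal.lift.{max u v} κ ∧
    IsSaturated L M κ ∧ IsStronglyHomogeneous L M κ

/-- The group of automorphisms of `M`, under composition. -/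
instance autGroup : Group (M ≃[L] M) where
  mul σ τ := σ.comp τ
  one := FirstOrder.Language.Equiv.refl L M
  inv σ := σ.symm
  mul_assoc _ _ _ := rfl
  one_mul _ := rfl
  mul_one _ := rfl
  inv_mul_cancel σ := FirstOrder.Language.Equiv.ext fun x => σ.symm_apply_apply x

/-- The space of complete types over `M` in the variables `x₀, …, xₙ₋₁`, with the topology from
Mathlib, in which the sets of types containing a given formula form a basis. -/
abbrev TypeSpace (n : ℕ) : Type (max u v w) := (L.elementaryDiagram M).CompleteType (Fin n)

variable {L M}

/-- The translation of languages that replaces each parameter `a` by `σ a` and keeps the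
variables. -/
def paramMap (n : ℕ) (σ : M ≃[L] M) : L[[M]][[Fin n]] →ᴸ L[[M]][[Fin n]] :=
  (L.lhomWithConstantsMap σ).addConstants (Fin n)

theorem paramMap_comp (n : ℕ) (σ τ : M ≃[L] M) :
    (paramMap n σ).comp (paramMap n τ) = paramMap n (σ * τ) := by
  refine FirstOrder.Language.LHom.funext ?_ ?_ <;> funext k x <;> rcases x with (x | x) | x
  all_goals first | rfl | (cases k <;> first | rfl | cases x)

theorem paramMap_one (n : ℕ) :
    paramMap n (1 : M ≃[L] M) = FirstOrder.Language.LHom.id (L[[M]][[Fin n]]) := by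
  refine FirstOrder.Language.LHom.funext ?_ ?_ <;> funext k x <;> rcases x with (x | x) | x
  all_goals first | rfl | (cases k <;> first | rfl | cases x)

theorem paramMap_paramMap (n : ℕ) (σ τ : M ≃[L] M) (φ : L[[M]][[Fin n]].Sentence) :
    (paramMap n σ).onSentence ((paramMap n τ).onSentence φ) =
      (paramMap n (σ * τ)).onSentence φ := by
  rw [← paramMap_comp]
  exact (congrFun (FirstOrder.Language.LHom.comp_onBoundedFormula
    (paramMap n σ) (paramMap n τ)) φ).symm

theorem paramMap_one_onSentence (n : ℕ) (φ : L[[M]][[Fin n]].Sentence) :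
    (paramMap n (1 : M ≃[L] M)).onSentence φ = φ := by
  rw [paramMap_one]
  exact congrFun FirstOrder.Language.LHom.id_onBoundedFormula φ

theorem paramMap_lhomWithConstants (n : ℕ) (σ : M ≃[L] M) (θ : L[[M]].Sentence) :
    (paramMap n σ).onSentence ((L[[M]].lhomWithConstants (Fin n)).onSentence θ) =
      (L[[M]].lhomWithConstants (Fin n)).onSentence ((L.lhomWithConstantsMap σ).onSentence θ) := by
  have h : (paramMap n σ).comp (L[[M]].lhomWithConstants (Fin n)) =
      (L[[M]].lhomWithConstants (Fin n)).comp (L.lhomWithConstantsMap σ) := rfl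
  have h₁ := congrFun (FirstOrder.Language.LHom.comp_onBoundedFormula (α := Empty) (n := 0)
    (paramMap n σ) (L[[M]].lhomWithConstants (Fin n))) θ
  have h₂ := congrFun (FirstOrder.Language.LHom.comp_onBoundedFormula (α := Empty) (n := 0)
    (L[[M]].lhomWithConstants (Fin n)) (L.lhomWithConstantsMap σ)) θ
  rw [h] at h₁
  exact h₁.symm.trans h₂

theorem map_mem_elementaryDiagram (σ : M ≃[L] M) {θ : L[[M]].Sentence}
    (h : θ ∈ L.elementaryDiagram M) :
    (L.lhomWithConstantsMap σ).onSentence θ ∈ L.elementaryDiagram M := by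
  have h₁ : (FirstOrder.Language.Formula.equivSentence.symm θ).Realize (id : M → M) :=
    (FirstOrder.Language.Formula.realize_equivSentence_symm M θ id).2 h
  have h₂ : (FirstOrder.Language.Formula.equivSentence.symm θ).Realize (σ ∘ (id : M → M)) :=
    (FirstOrder.Language.StrongHomClass.realize_formula σ _).2 h₁
  rw [FirstOrder.Language.Formula.realize_equivSentence_symm] at h₂
  have h₃ : @FirstOrder.Language.LHom.IsExpansionOn _ _ (L.lhomWithConstantsMap σ) M
      (@FirstOrder.Language.withConstantsStructure L M _ M
        (FirstOrder.Language.constantsOn.structure (σ ∘ (id : M → M)))) _ := by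
    refine @FirstOrder.Language.LHom.IsExpansionOn.mk _ _ _ M
      (@FirstOrder.Language.withConstantsStructure L M _ M
        (FirstOrder.Language.constantsOn.structure (σ ∘ (id : M → M)))) _ ?_ ?_
    · intro k f x
      rcases f with f | f
      · rfl
      · cases k
        · rfl
        · cases f
    · intro k r x
      rcases r with r | r
      · rfl
      · cases r
  exact (@FirstOrder.Language.LHom.realize_onSentence _ _ M
    (@FirstOrder.Language.withConstantsStructure L M _ M
        (FirstOrder.Language.constantsOn.structure (σ ∘ (id : M → M)))) _ _ h₃ θ).2 h₂

/-- The action of an automorphism `σ` on a type `p`: the type `σ • p` consists of the formulas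
whose image under `σ⁻¹` lies in `p`; equivalently, `σ • p = {φ(x, σ a) | φ(x, a) ∈ p}`. -/
def smulType (n : ℕ) (σ : M ≃[L] M) (p : TypeSpace L M n) : TypeSpace L M n where
  toTheory := {φ | (paramMap n σ⁻¹).onSentence φ ∈ p}
  subset' := by
    rintro _ ⟨θ, hθ, rfl⟩
    refine p.subset ⟨_, map_mem_elementaryDiagram σ⁻¹ hθ, ?_⟩
    exact (paramMap_lhomWithConstants n σ⁻¹ θ).symm
  isMaximal' := by
    refine ⟨FirstOrder.Language.Theory.isSatisfiable_of_isSatisfiable_onTheory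
      (paramMap n σ⁻¹) (p.isMaximal.1.mono ?_), fun φ => p.mem_or_not_mem _⟩
    rintro _ ⟨φ, hφ, rfl⟩
    exact hφ

/-- The automorphism group acts on the space of types. -/
instance typeAction (n : ℕ) : MulAction (M ≃[L] M) (TypeSpace L M n) where
  smul σ p := smulType n σ p
  one_smul p := SetLike.ext fun φ => by
    change (paramMap n (1 : M ≃[L] M)⁻¹).onSentence φ ∈ p ↔ φ ∈ p
    rw [inv_one, paramMap_one_onSentence]
  mul_smul σ τ p := SetLike.ext fun φ => by
    change (paramMap n (σ * τ)⁻¹).onSentence φ ∈ p ↔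
      (paramMap n τ⁻¹).onSentence ((paramMap n σ⁻¹).onSentence φ) ∈ p
    rw [paramMap_paramMap, mul_inv_rev]

/-- `φ(x, σ a) ∈ σ • p` if and only if `φ(x, a) ∈ p`. -/
theorem onSentence_mem_smul_iff (n : ℕ) (σ : M ≃[L] M) (p : TypeSpace L M n)
    (φ : L[[M]][[Fin n]].Sentence) : (paramMap n σ).onSentence φ ∈ σ • p ↔ φ ∈ p := by
  change (paramMap n σ⁻¹).onSentence ((paramMap n σ).onSentence φ) ∈ p ↔ φ ∈ p
  rw [paramMap_paramMap, inv_mul_cancel, paramMap_one_onSentence]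

/-- Every automorphism acts on the space of types as a homeomorphism. -/
instance typeAction_continuous (n : ℕ) :
    ContinuousConstSMul (M ≃[L] M) (TypeSpace L M n) where
  continuous_const_smul σ := by
    refine CompleteType.isTopologicalBasis_range_typesWith.continuous_iff.2 ?_
    rintro _ ⟨φ, rfl⟩
    exact CompleteType.isOpen_typesWith ((paramMap n σ⁻¹).onSentence φ)

end ModelTh

/-! ### Rank zero and continuity -/

namespace BetaRank

variable {X : Type u} [TopologicalSpace X]

/-! Part 1 reduces to part 2. A rank is a supremum, so it vanishes exactly when every first
derivative of the whole space is empty. On a compact Hausdorff space the neighbourhoods of the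
diagonal are the entourages, so this says that no point is a point of oscillation, which is
continuity (`rankFun_eq_zero_iff`, `rank_eq_zero_iff`).

Part 2 is a double limit argument. If some η in the Ellis semigroup is discontinuous, then for some
formula ψ there is a type p with ψ ∉ η p in the closure of the types q with ψ ∈ η q. Choosing
alternately types q_i near p and automorphisms σ_j near η gives ψ ∈ σ_j • q_i iff i ≤ j, and
compactness turns this into the order property (`continuous_of_isStable`, `not_isStable_of_types`).

Conversely, let b_i, a_j in the monster model witness the order property of φ. The a_j can be taken
of one type (`exists_order_of_not_isStable`), so homogeneity gives σ_j with σ_j a_j = a_0. Let p and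
η be limits of tp(b_i) and of σ_j along a nonprincipal ultrafilter. Then φ(x, a_0) lies in
η(tp(b_i)) for every i but not in η(p), so η is discontinuous (`exists_not_continuous`). -/

theorem oscDeriv_subset (f : X → X) (W : Set (X × X)) (Y : Set X) : oscDeriv f W Y ⊆ Y :=
  fun _ h => h.1

theorem iterDeriv_zero (f : X → X) (W : Set (X × X)) (Y : Set X) : iterDeriv f W Y 0 = Y :=
  Ordinal.limitRecOn_zero ..

theorem iterDeriv_succ (f : X → X) (W : Set (X × X)) (Y : Set X) (α : Ordinal.{u}) :
    iterDeriv f W Y (α + 1) = oscDeriv f W (iterDeriv f W Y α) :=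
  Ordinal.limitRecOn_add_one ..

theorem iterDeriv_limit (f : X → X) (W : Set (X × X)) (Y : Set X) {γ : Ordinal.{u}}
    (hγ : Order.IsSuccLimit γ) : iterDeriv f W Y γ = ⋂ δ < γ, iterDeriv f W Y δ :=
  Ordinal.limitRecOn_limit _ _ _ _ hγ

theorem iterDeriv_one (f : X → X) (W : Set (X × X)) (Y : Set X) :
    iterDeriv f W Y 1 = oscDeriv f W Y := by
  have := iterDeriv_succ f W Y 0
  rwa [iterDeriv_zero, zero_add] at this

/-- Derivatives only shrink, so the first one decides whether any later one can be nonempty. -/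
theorem iterDeriv_subset_oscDeriv (f : X → X) (W : Set (X × X)) (Y : Set X) {α : Ordinal.{u}}
    (hα : α ≠ 0) : iterDeriv f W Y α ⊆ oscDeriv f W Y := by
  induction α using Ordinal.limitRecOn with
  | zero => exact absurd rfl hα
  | add_one β ih =>
    rw [iterDeriv_succ]
    rcases eq_or_ne β 0 with rfl | hβ
    · rw [iterDeriv_zero]
    · exact (oscDeriv_subset f W _).trans (ih hβ)
  | limit γ hγ _ =>
    rw [iterDeriv_limit f W Y hγ, ← iterDeriv_one]
    have h1 : 1 < γ := by
      have := hγ.succ_lt (pos_iff_ne_zero.2 hα)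
      rwa [Order.succ_eq_add_one, zero_add] at this
    exact Set.biInter_subset_of_mem h1

theorem rankAt_eq_zero_iff (f : X → X) (W : Set (X × X)) :
    rankAt f W = 0 ↔ oscDeriv f W Set.univ = ∅ := by
  -- Zero is the bottom element, so a supremum is zero exactly when every term is.
  have h0 : (0 : WithTop Ordinal.{u}) = ⊥ := rfl
  rw [rankAt, h0, sSup_eq_bot, Set.forall_mem_image]
  constructor
  · intro h
    by_contra hne
    have h1 : (1 : Ordinal.{u}) ∈ {α | (iterDeriv f W Set.univ α).Nonempty} := by
      change (iterDeriv f W Set.univ 1).Nonempty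
      rw [iterDeriv_one]
      exact Set.nonempty_iff_ne_empty.2 hne
    have := h h1
    rw [← h0] at this
    exact one_ne_zero (WithTop.coe_eq_zero.1 this)
  · intro h α hα
    by_contra hne
    have hα0 : α ≠ 0 := fun h => hne (by rw [h]; rfl)
    have hs := iterDeriv_subset_oscDeriv f W Set.univ hα0
    rw [h] at hs
    exact (hα.mono hs).ne_empty rfl

/-- A self-map of a compact Hausdorff space has rank zero exactly when it is continuous. -/
theorem rankFun_eq_zero_iff [CompactSpace X] [T2Space X] (f : X → X) :
    rankFun f = 0 ↔ Continuous f := by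
  have h0 : (0 : WithTop Ordinal.{u}) = ⊥ := rfl
  have key : rankFun f = 0 ↔ ∀ W ∈ 𝓝ˢ (Set.diagonal X), oscDeriv f W Set.univ = ∅ := by
    simp only [← rankAt_eq_zero_iff, h0, rankFun, iSup_eq_bot]
  rw [key]
  let : UniformSpace X := uniformSpaceOfCompactR1
  have hU : 𝓝ˢ (Set.diagonal X) = uniformity X := nhdsSet_diagonal_eq_uniformity
  constructor
  · intro h
    rw [continuous_iff_continuousAt]
    intro x
    rw [ContinuousAt, Uniform.tendsto_nhds_right, Filter.tendsto_def]
    intro W hW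
    have hx : x ∉ oscDeriv f W Set.univ := by
      rw [h W (hU ▸ hW)]
      exact Set.notMem_empty x
    simp only [oscDeriv, Set.mem_ofPred_eq, Set.mem_univ, true_and, not_forall, Set.inter_univ,
      not_exists, not_and, not_not] at hx
    obtain ⟨V, hV, hxV, hVW⟩ := hx
    filter_upwards [hV.mem_nhds hxV] with y hy using hVW x hxV y hy
  · intro hf W hW
    rw [Set.eq_empty_iff_forall_notMem]
    rintro x ⟨-, hx⟩
    have hW' : W ∈ 𝓝 (f x, f x) := mem_nhdsSet_iff_forall.1 hW _ rfl
    -- A square inside W is needed because both points of an oscillating pair vary.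
    obtain ⟨U, hU1, hxU, hUW⟩ : ∃ U : Set X, IsOpen U ∧ f x ∈ U ∧ U ×ˢ U ⊆ W := by
      obtain ⟨A, B, hA, hxA, hB, hxB, hAB⟩ := mem_nhds_prod_iff'.1 hW'
      exact ⟨A ∩ B, hA.inter hB, ⟨hxA, hxB⟩,
        (Set.prod_mono Set.inter_subset_left Set.inter_subset_right).trans hAB⟩
    obtain ⟨v₁, h₁, v₂, h₂, h⟩ := hx _ (hU1.preimage hf) hxU
    exact h (hUW ⟨h₁.1, h₂.1⟩)

theorem rank_eq_zero_iff (X : Type u) [TopologicalSpace X] [CompactSpace X] [T2Space X]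
    (G : Type v) [Group G] [MulAction G X] :
    rank X G = 0 ↔ ∀ η ∈ ellisSemigroup X G, Continuous η := by
  have h0 : (0 : WithTop Ordinal.{u}) = ⊥ := rfl
  simp only [← rankFun_eq_zero_iff, h0, rank, iSup_eq_bot]

end BetaRank

/-! ### Compactness, saturation and homogeneity -/

namespace ModelTh

open FirstOrder.Language

variable {L : FirstOrder.Language.{u, v}}

/-- Compactness for sets of formulas in small sets of variables. -/
theorem exists_model_realizing (T : L.Theory) {V : Type} (Γ : Set (L.Formula V)) (N : Type w)
    [L.Structure N] [Nonempty N] [N ⊨ T]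
    (h : ∀ s : Finset (L.Formula V), (s : Set (L.Formula V)) ⊆ Γ →
      ∃ v : V → N, ∀ φ ∈ s, φ.Realize v) :
    ∃ (N' : T.ModelType.{u, v, max u v}) (v : V → N'), ∀ φ ∈ Γ, φ.Realize v := by
  classical
  have hsat : Theory.IsSatisfiable
      ((L.lhomWithConstants V).onTheory T ∪ Formula.equivSentence '' Γ) := by
    rw [Theory.isSatisfiable_iff_isFinitelySatisfiable]
    intro T₀ hT₀
    -- Only the sentences of T₀ that come from Γ constrain the valuation; the others hold in N
    -- because N is a model of T.
    obtain ⟨v, hv⟩ := h ((T₀.image Formula.equivSentence.symm).filter (· ∈ Γ))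
      (fun φ hφ => (Finset.mem_filter.1 hφ).2)
    let : (constantsOn V).Structure N := constantsOn.structure v
    have : N ⊨ (T₀ : L[[V]].Theory) := by
      rw [Theory.model_iff]
      intro θ hθ
      rcases hT₀ hθ with hθ' | ⟨φ, hφ, rfl⟩
      · exact ((LHom.onTheory_model (L.lhomWithConstants V) T).2 ‹_›).realize_of_mem θ hθ'
      · rw [Formula.realize_equivSentence]
        exact hv φ (Finset.mem_filter.2
          ⟨Finset.mem_image.2 ⟨_, hθ, Equiv.symm_apply_apply _ _⟩, hφ⟩)
    exact Theory.Model.isSatisfiable N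
  obtain ⟨M⟩ := hsat
  let : L.Structure M := (L.lhomWithConstants V).reduct M
  have : M ⊨ T := (LHom.onTheory_model (L.lhomWithConstants V) T).1
    (Theory.Model.mono M.is_model Set.subset_union_left)
  refine ⟨Theory.ModelType.of T M, fun a => (L.con a : M), fun φ hφ => ?_⟩
  exact (Formula.realize_equivSentence M φ).1
    (M.is_model.realize_of_mem _ (Or.inr ⟨φ, hφ, rfl⟩))

/-- The "forth" step: the type of the last entry of w over the earlier ones, transported to
parameters in e, is finitely satisfiable because existential formulas transfer along `he`.
Saturation then realizes it. -/
theorem model_realize_extend {C : Type w} [L.Structure C] {κ : Cardinal.{w}} (hκ : ℵ₀ ≤ κ)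
    (hC : IsSaturated L C κ) {N : Type*} [L.Structure N] {k : ℕ} (e : Fin k → C)
    (w : Fin (k + 1) → N)
    (he : ∀ θ : L.Formula (Fin k), θ.Realize e ↔ θ.Realize fun i => w i.castSucc) :
    ∃ x : C, ∀ θ : L.Formula (Fin (k + 1)),
      θ.Realize (Fin.snoc e x : Fin (k + 1) → C) ↔ θ.Realize w := by
  classical
  let g : Fin (k + 1) → Set.range e ⊕ Fin 1 :=
    Fin.snoc (fun i => Sum.inl ⟨e i, i, rfl⟩) (Sum.inr 0)
  have hg : ∀ x : C, Sum.elim (fun a : Set.range e => (a : C)) (fun _ => x) ∘ g =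
      (Fin.snoc e x : Fin (k + 1) → C) := by
    intro x
    funext i
    refine Fin.lastCases ?_ (fun i => ?_) i <;> simp [g]
  have hlt : #(Set.range e) < κ :=
    (Cardinal.lt_aleph0_of_finite (Set.range e)).trans_le hκ
  obtain ⟨x, hx⟩ := hC (Set.range e) hlt
    {ψ | ∃ θ : L.Formula (Fin (k + 1)), θ.Realize w ∧ θ.relabel g = ψ} (by
      intro s hs
      -- Relabelling by `g` may identify variables, as e may repeat entries, so a preimage of each ψ
      -- is chosen. The map `g'` keeps the variables apart, which makes the existential formula one
      -- about the tuple e.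
      choose! θ hθ hθs using fun ψ (h : ψ ∈ s) => hs h
      let g' : Fin (k + 1) → Fin k ⊕ Fin 1 := Fin.snoc (fun i => Sum.inl i) (Sum.inr 0)
      have hg' : ∀ (a : Fin k → C) (x : Fin 1 → C),
          Sum.elim a x ∘ g' = (Fin.snoc a (x 0) : Fin (k + 1) → C) := by
        intro a x
        funext i
        refine Fin.lastCases ?_ (fun i => ?_) i <;> simp [g']
      have hN : (((Formula.iInf fun ψ : s => θ ψ).relabel g').iExs (Fin 1)).Realize
          fun i => w i.castSucc := by
        rw [Formula.realize_iExs]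
        refine ⟨fun _ => w (Fin.last k), ?_⟩
        have hgN : Sum.elim (fun i : Fin k => w i.castSucc) (fun _ => w (Fin.last k)) ∘ g' = w := by
          funext i
          refine Fin.lastCases ?_ (fun i => ?_) i <;> simp [g']
        rw [Formula.realize_relabel, hgN, Formula.realize_iInf]
        intro ψ
        exact hθ ψ ψ.2
      rw [← he, Formula.realize_iExs] at hN
      obtain ⟨b, hb⟩ := hN
      rw [Formula.realize_relabel, hg', Formula.realize_iInf] at hb
      refine ⟨b 0, fun ψ hψ => ?_⟩
      rw [← hθs ψ hψ, Formula.realize_relabel, hg]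
      exact hb ⟨ψ, hψ⟩)
  have hx' : ∀ θ : L.Formula (Fin (k + 1)), θ.Realize w →
      θ.Realize (Fin.snoc e x : Fin (k + 1) → C) := by
    intro θ hθ
    have := hx _ ⟨θ, hθ, rfl⟩
    rwa [Formula.realize_relabel, hg] at this
  refine ⟨x, fun θ => ⟨fun h => ?_, hx' θ⟩⟩
  -- The type of w is complete, so the converse follows from the negated formula.
  by_contra hn
  have := hx' θ.not (by simpa using hn)
  exact (Formula.realize_not.1 this) h

/-- The sequence is built one entry at a time. Each step has finitely many parameters, so ℵ₀ ≤ κ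
suffices. Completeness of T starts the induction: formulas without variables are sentences, on which
C and N agree. -/
theorem realize_nat_embedding {T : L.Theory} (hT : T.IsComplete) {C : Type w} [L.Structure C]
    [Nonempty C] [C ⊨ T] {κ : Cardinal.{w}} (hκ : ℵ₀ ≤ κ) (hC : IsSaturated L C κ)
    {N : Type*} [L.Structure N] [Nonempty N] [N ⊨ T] (w : ℕ → N) :
    ∃ d : ℕ → C, ∀ (k : ℕ) (θ : L.Formula (Fin k)),
      θ.Realize (fun i => d i) ↔ θ.Realize fun i => w i := by
  let P : ∀ k : ℕ, (Fin k → C) → Prop := fun k e =>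
    ∀ θ : L.Formula (Fin k), θ.Realize e ↔ θ.Realize fun i => w i
  have h0 : P 0 Fin.elim0 := by
    intro θ
    let θ' : L.Sentence := θ.relabel (Fin.elim0 : Fin 0 → Empty)
    have h1 : C ⊨ θ' ↔ θ.Realize (Fin.elim0 : Fin 0 → C) := by
      change (θ.relabel _).Realize _ ↔ _
      rw [Formula.realize_relabel, Subsingleton.elim (_ ∘ _) (Fin.elim0 : Fin 0 → C)]
    have h2 : N ⊨ θ' ↔ θ.Realize fun i : Fin 0 => w i := by
      change (θ.relabel _).Realize _ ↔ _
      rw [Formula.realize_relabel, Subsingleton.elim (_ ∘ _) fun i : Fin 0 => w i]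
    rw [← h1, ← h2, hT.realize_sentence_iff, hT.realize_sentence_iff]
  have hstep : ∀ k (e : Fin k → C), P k e → ∃ x : C, P (k + 1) (Fin.snoc e x) := fun k e he =>
    model_realize_extend hκ hC e (fun i : Fin (k + 1) => w i) he
  choose f hf using hstep
  let E : ∀ k, {e : Fin k → C // P k e} := fun k =>
    Nat.rec ⟨Fin.elim0, h0⟩ (fun k e => ⟨Fin.snoc e.1 (f k e.1 e.2), hf k e.1 e.2⟩) k
  have hE : ∀ k (i : Fin k), (E k).1 i = (E (i + 1)).1 (Fin.last i) := by
    intro k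
    induction k with
    | zero => exact fun i => i.elim0
    | succ k ih =>
      intro i
      refine Fin.lastCases rfl (fun i => ?_) i
      refine Eq.trans ?_ (ih i)
      exact Fin.snoc_castSucc (α := fun _ => C) _ _ i
  refine ⟨fun k => (E (k + 1)).1 (Fin.last k), fun k θ => ?_⟩
  rw [← (E k).2 θ, ← funext (hE k)]

/-- In a saturated model of a complete theory, the type of every countable family of elements of
a model is realized. -/
theorem realize_countable_family {T : L.Theory} (hT : T.IsComplete) {C : Type w} [L.Structure C]
    [Nonempty C] [C ⊨ T] {κ : Cardinal.{w}} (hκ : ℵ₀ ≤ κ) (hC : IsSaturated L C κ)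
    {N : Type*} [L.Structure N] [Nonempty N] [N ⊨ T] {V : Type*} [Countable V] (w : V → N) :
    ∃ d : V → C, ∀ θ : L.Formula V, θ.Realize d ↔ θ.Realize w := by
  classical
  have := Encodable.ofCountable V
  -- Natural numbers that encode no element of V receive an arbitrary value, which the formulas in
  -- question never mention.
  obtain ⟨d, hd⟩ := realize_nat_embedding hT hκ hC
    fun k => ((Encodable.decode k : Option V).map w).getD (Classical.arbitrary N)
  refine ⟨fun a => d (Encodable.encode a), fun θ => ?_⟩
  let k := θ.freeVarFinset.sup Encodable.encode + 1
  let f : θ.freeVarFinset → Fin k := fun a =>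
    ⟨Encodable.encode (a : V), Nat.lt_succ_of_le (Finset.le_sup (f := Encodable.encode) a.2)⟩
  have h := hd k (θ.restrictFreeVar f)
  have hl := BoundedFormula.realize_restrictFreeVar (φ := θ) (f := f) (v := fun i : Fin k => d i)
    (xs := default) (fun a => d (Encodable.encode a)) (fun a => rfl)
  have hr := BoundedFormula.realize_restrictFreeVar (φ := θ) (f := f) (v := fun i : Fin k =>
    ((Encodable.decode (i : ℕ) : Option V).map w).getD (Classical.arbitrary N))
    (xs := default) w (fun a => by simp [f])
  exact hl.symm.trans (h.trans hr)

/-- Tuples of the same type in a strongly homogeneous structure are conjugate. -/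
theorem exists_automorphism {C : Type w} [L.Structure C] {κ : Cardinal.{w}} (hκ : ℵ₀ ≤ κ)
    (hC : IsStronglyHomogeneous L C κ) {m : ℕ} (a b : Fin m → C)
    (h : ∀ ψ : L.Formula (Fin m), ψ.Realize a ↔ ψ.Realize b) : ∃ σ : C ≃[L] C, σ ∘ a = b := by
  choose g hg using fun x : Set.range a => x.2
  have hlt : #(Set.range a) < κ := (Cardinal.lt_aleph0_of_finite (Set.range a)).trans_le hκ
  obtain ⟨σ, hσ⟩ := hC (Set.range a) hlt (fun x => b (g x)) (by
    intro φ
    have := h (φ.relabel g)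
    rw [Formula.realize_relabel, Formula.realize_relabel] at this
    rw [← (funext hg : a ∘ g = fun x : Set.range a => (x : C))]
    exact this.symm)
  refine ⟨σ, funext fun k => ?_⟩
  -- The index chosen for the element a k may differ from k. Equality of coordinates is part of the
  -- type, so b takes the same value at both indices.
  have h1 := h ((Term.var (g ⟨a k, k, rfl⟩)).equal (Term.var k))
  simp only [Formula.realize_equal, Term.realize_var] at h1
  exact (hσ ⟨a k, k, rfl⟩).trans (h1.1 (hg ⟨a k, k, rfl⟩))

end ModelTh

/-! ### Formulas with parameters and types over a model -/

namespace ModelTh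

open FirstOrder.Language

variable {L : FirstOrder.Language.{u, v}} {M : Type w}

/-- The sentence over the parameters and the constants for the variables that corresponds to a
formula with parameters in `M`. -/
noncomputable def paramSentence {n : ℕ} (χ : L.Formula (M ⊕ Fin n)) : L[[M]][[Fin n]].Sentence :=
  Formula.equivSentence (BoundedFormula.constantsVarsEquiv.symm χ)

theorem paramSentence_surjective {n : ℕ} :
    Function.Surjective (paramSentence : L.Formula (M ⊕ Fin n) → L[[M]][[Fin n]].Sentence) :=
  Formula.equivSentence.surjective.comp BoundedFormula.constantsVarsEquiv.symm.surjective

theorem realize_paramSentence {n : ℕ} {N : Type*} [L.Structure N] (j : M → N) (v : Fin n → N)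
    (χ : L.Formula (M ⊕ Fin n)) :
    @Sentence.Realize _ N (@withConstantsStructure L[[M]] N
      (@withConstantsStructure L N _ M (constantsOn.structure j)) (Fin n)
        (constantsOn.structure v)) (paramSentence χ) ↔ χ.Realize (Sum.elim j v) := by
  let : (constantsOn M).Structure N := constantsOn.structure j
  let : (constantsOn (Fin n)).Structure N := constantsOn.structure v
  rw [← Formula.realize_equivSentence_symm, paramSentence, Equiv.symm_apply_apply,
    Formula.Realize, ← BoundedFormula.realize_constantsVarsEquiv, Equiv.apply_symm_apply]
  rfl

/-- The formula `φ(x, a)` with parameters `a` in `M`. -/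
def inst {n m : ℕ} (φ : L.Formula (Fin n ⊕ Fin m)) (a : Fin m → M) : L.Formula (M ⊕ Fin n) :=
  φ.relabel (Sum.elim Sum.inr (Sum.inl ∘ a))

theorem realize_inst {n m : ℕ} (φ : L.Formula (Fin n ⊕ Fin m)) (a : Fin m → M) {N : Type*}
    [L.Structure N] (j : M → N) (v : Fin n → N) :
    (inst φ a).Realize (Sum.elim j v) ↔ φ.Realize (Sum.elim v (j ∘ a)) := by
  rw [inst, Formula.realize_relabel, Sum.comp_elim, ← Function.comp_assoc, Sum.elim_comp_inl,
    Sum.elim_comp_inr]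

variable [L.Structure M]

/-- The two interpretations differ only in the constants for parameters, and renaming a to σ a there
amounts to precomposing j with σ. -/
theorem realize_paramMap {n : ℕ} {N : Type*} [L.Structure N] (j : M → N) (v : Fin n → N)
    (σ : M ≃[L] M) (ψ : L[[M]][[Fin n]].Sentence) :
    @Sentence.Realize _ N (@withConstantsStructure L[[M]] N
      (@withConstantsStructure L N _ M (constantsOn.structure j)) (Fin n)
        (constantsOn.structure v)) ((paramMap n σ).onSentence ψ) ↔
    @Sentence.Realize _ N (@withConstantsStructure L[[M]] N
      (@withConstantsStructure L N _ M (constantsOn.structure (j ∘ σ))) (Fin n)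
        (constantsOn.structure v)) ψ := by
  refine @LHom.realize_onSentence _ _ N (@withConstantsStructure L[[M]] N
      (@withConstantsStructure L N _ M (constantsOn.structure (j ∘ σ))) (Fin n)
        (constantsOn.structure v)) (@withConstantsStructure L[[M]] N
      (@withConstantsStructure L N _ M (constantsOn.structure j)) (Fin n)
        (constantsOn.structure v)) (paramMap n σ) (@LHom.IsExpansionOn.mk _ _ _ N
      (@withConstantsStructure L[[M]] N
      (@withConstantsStructure L N _ M (constantsOn.structure (j ∘ σ))) (Fin n)
        (constantsOn.structure v)) (@withConstantsStructure L[[M]] N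
      (@withConstantsStructure L N _ M (constantsOn.structure j)) (Fin n)
        (constantsOn.structure v)) ?_ ?_) ψ
  · rintro k ((f | f) | f) x
    · rfl
    · cases k
      · rfl
      · cases f
    · cases k
      · rfl
      · cases f
  · rintro k ((r | r) | r) x
    · rfl
    · cases r
    · cases r

/-- Every type over `M` is the type of a tuple in an elementary extension of `M`. -/
theorem exists_elementary_realization {n : ℕ} (p : TypeSpace L M n) :
    ∃ (N : Type (max u v w)) (_ : L.Structure N) (j : M ↪ₑ[L] N) (v : Fin n → N),
      ∀ ψ : L[[M]][[Fin n]].Sentence, ψ ∈ p ↔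
        @Sentence.Realize _ N (@withConstantsStructure L[[M]] N
          (@withConstantsStructure L N _ M (constantsOn.structure j)) (Fin n)
            (constantsOn.structure v)) ψ := by
  obtain ⟨N, v, rfl⟩ := Theory.exists_modelType_is_realized_in _ p
  let : L.Structure N := (L.lhomWithConstants M).reduct N
  refine ⟨N, inferInstance, ElementaryEmbedding.ofModelsElementaryDiagram L M N, v, fun ψ => ?_⟩
  rw [Theory.CompleteType.mem_typeOf, Formula.realize_equivSentence_symm]
  -- The given structure on N is recovered from its reduct and the embedding; for a constant symbol
  -- the only point is that the empty argument tuple is unique.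
  have hs : @withConstantsStructure L N _ M
      (constantsOn.structure (ElementaryEmbedding.ofModelsElementaryDiagram L M N)) = N.struc := by
    refine Structure.ext ?_ ?_
    · funext k f x
      rcases f with f | f
      · rfl
      · cases k
        · exact congrArg (@Structure.funMap L[[M]] N N.struc 0 (Sum.inr f)) (Subsingleton.elim _ x)
        · cases f
    · funext k r x
      rcases r with r | r
      · rfl
      · cases r
  rw [hs]

theorem paramSentence_mem_iff {n : ℕ} {p : TypeSpace L M n} {N : Type*} [L.Structure N]
    {j : M → N} {v : Fin n → N}
    (h : ∀ ψ : L[[M]][[Fin n]].Sentence, ψ ∈ p ↔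
        @Sentence.Realize _ N (@withConstantsStructure L[[M]] N
          (@withConstantsStructure L N _ M (constantsOn.structure j)) (Fin n)
            (constantsOn.structure v)) ψ) (χ : L.Formula (M ⊕ Fin n)) :
    paramSentence χ ∈ p ↔ χ.Realize (Sum.elim j v) :=
  (h _).trans (realize_paramSentence j v χ)

theorem paramSentence_mem_smul_iff {n : ℕ} (σ : M ≃[L] M) (p : TypeSpace L M n)
    (χ : L.Formula (M ⊕ Fin n)) :
    paramSentence χ ∈ σ • p ↔ paramSentence (χ.relabel (Sum.map σ.symm id)) ∈ p := by
  obtain ⟨N, _, j, v, h⟩ := exists_elementary_realization p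
  rw [paramSentence_mem_iff h, Formula.realize_relabel, Sum.elim_comp_map, Function.comp_id]
  change (paramMap n σ⁻¹).onSentence (paramSentence χ) ∈ p ↔ _
  rw [h, realize_paramMap, realize_paramSentence]
  rfl

theorem paramSentence_not_mem_iff {n : ℕ} (p : TypeSpace L M n) (χ : L.Formula (M ⊕ Fin n)) :
    paramSentence χ.not ∈ p ↔ paramSentence χ ∉ p := by
  obtain ⟨N, _, j, v, h⟩ := exists_elementary_realization p
  rw [paramSentence_mem_iff h, paramSentence_mem_iff h, Formula.realize_not]

/-- Finitely many formulas of a type over `M` have a common solution in `M`. -/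
theorem exists_realize_of_mem {n : ℕ} (p : TypeSpace L M n) {ι : Type*} [Finite ι]
    (χ : ι → L.Formula (M ⊕ Fin n)) (h : ∀ i, paramSentence (χ i) ∈ p) :
    ∃ b : Fin n → M, ∀ i, (χ i).Realize (Sum.elim id b) := by
  obtain ⟨N, _, j, v, hp⟩ := exists_elementary_realization p
  have hN : ((Formula.iInf χ).iExs (Fin n)).Realize (j ∘ (id : M → M)) := by
    rw [Formula.realize_iExs]
    exact ⟨v, Formula.realize_iInf.2 fun i => (paramSentence_mem_iff hp _).1 (h i)⟩
  rw [ElementaryEmbedding.map_formula, Formula.realize_iExs] at hN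
  obtain ⟨b, hb⟩ := hN
  exact ⟨b, fun i => Formula.realize_iInf.1 hb i⟩

/-- The type over `M` of a tuple in `M`. -/
noncomputable def tupleType [Nonempty M] {n : ℕ} (b : Fin n → M) : TypeSpace L M n :=
  (L.elementaryDiagram M).typeOf b

theorem paramSentence_mem_tupleType [Nonempty M] {n : ℕ} (b : Fin n → M)
    (χ : L.Formula (M ⊕ Fin n)) :
    paramSentence χ ∈ tupleType (L := L) b ↔ χ.Realize (Sum.elim id b) := by
  refine paramSentence_mem_iff (j := id) (fun ψ => ?_) χ
  rw [tupleType, Theory.CompleteType.mem_typeOf, Formula.realize_equivSentence_symm]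

theorem inst_mem_smul_iff {n m : ℕ} (φ : L.Formula (Fin n ⊕ Fin m)) (a : Fin m → M)
    (σ : M ≃[L] M) (p : TypeSpace L M n) :
    paramSentence (inst φ a) ∈ σ • p ↔ paramSentence (inst φ (σ.symm ∘ a)) ∈ p := by
  rw [paramSentence_mem_smul_iff]
  obtain ⟨N, _, j, v, h⟩ := exists_elementary_realization p
  rw [paramSentence_mem_iff h, paramSentence_mem_iff h, realize_inst, Formula.realize_relabel,
    Sum.elim_comp_map, Function.comp_id, realize_inst]
  rfl

/-- A formula mentions finitely many parameters. Gathering them into a tuple yields a parameter-free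
φ(x, y), the kind of formula that stability speaks about. -/
theorem exists_inst {n : ℕ} (ψ : L[[M]][[Fin n]].Sentence) :
    ∃ (m : ℕ) (φ : L.Formula (Fin n ⊕ Fin m)) (a : Fin m → M),
      ∀ p : TypeSpace L M n, ψ ∈ p ↔ paramSentence (inst φ a) ∈ p := by
  classical
  obtain ⟨χ, rfl⟩ := paramSentence_surjective ψ
  let A : Finset M := χ.freeVarFinset.preimage Sum.inl Sum.inl_injective.injOn
  let a : Fin A.card → M := fun i => A.equivFin.symm i
  let f : χ.freeVarFinset → Fin n ⊕ Fin A.card := fun x => match x with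
    | ⟨Sum.inl y, hy⟩ => Sum.inr (A.equivFin ⟨y, Finset.mem_preimage.2 hy⟩)
    | ⟨Sum.inr i, _⟩ => Sum.inl i
  refine ⟨A.card, χ.restrictFreeVar f, a, fun p => ?_⟩
  obtain ⟨N, _, j, v, h⟩ := exists_elementary_realization p
  rw [paramSentence_mem_iff h, paramSentence_mem_iff h, realize_inst]
  refine (BoundedFormula.realize_restrictFreeVar (Sum.elim j v) ?_).symm
  rintro ⟨y | i, hy⟩
  · simp [f, a]
  · simp [f]

theorem isClopen_typesWith {n : ℕ} (ψ : L[[M]][[Fin n]].Sentence) :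
    IsClopen {p : TypeSpace L M n | ψ ∈ p} :=
  CompleteType.isClopen_typesWith ψ

end ModelTh

/-! ### The order property and the Ellis semigroup -/

namespace ModelTh

open FirstOrder.Language

variable {L : FirstOrder.Language.{u, v}}

/-- The formula on two sequences of tuples which says that `φ(bᵢ, aⱼ)` holds if `i ≤ j`, and that
it fails otherwise. -/
def orderFormula {n m : ℕ} (φ : L.Formula (Fin n ⊕ Fin m)) (i j : ℕ) :
    L.Formula ((ℕ × Fin n) ⊕ (ℕ × Fin m)) :=
  if i ≤ j then φ.relabel (Sum.map (Prod.mk i) (Prod.mk j))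
  else (φ.relabel (Sum.map (Prod.mk i) (Prod.mk j))).not

theorem realize_orderFormula {n m : ℕ} (φ : L.Formula (Fin n ⊕ Fin m)) (i j : ℕ) {N : Type*}
    [L.Structure N] (v : (ℕ × Fin n) ⊕ (ℕ × Fin m) → N) :
    (orderFormula φ i j).Realize v ↔
      (φ.Realize (Sum.elim (fun k => v (Sum.inl (i, k))) fun k => v (Sum.inr (j, k))) ↔
        i ≤ j) := by
  have h : (φ.relabel (Sum.map (Prod.mk i) (Prod.mk j))).Realize v ↔
      φ.Realize (Sum.elim (fun k => v (Sum.inl (i, k))) fun k => v (Sum.inr (j, k))) := by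
    rw [Formula.realize_relabel, ← Sum.elim_comp_inl_inr (v ∘ _)]
    rfl
  by_cases hij : i ≤ j
  · rw [orderFormula, if_pos hij, h, iff_true_right hij]
  · rw [orderFormula, if_neg hij, Formula.realize_not, h, iff_false_right hij]

/-- The types need not be realized in C, but any finite part of the order pattern is. Compactness
assembles these parts, and also moves the pattern to a model in the universe used by `IsStable`. -/
theorem not_isStable_of_types {T : L.Theory} {C : Type w} [L.Structure C] [Nonempty C] [C ⊨ T]
    {n m : ℕ} (φ : L.Formula (Fin n ⊕ Fin m)) (p : ℕ → TypeSpace L C n) (a : ℕ → Fin m → C)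
    (h : ∀ i j, paramSentence (inst φ (a j)) ∈ p i ↔ i ≤ j) : ¬ IsStable T := by
  obtain ⟨N, v, hv⟩ := exists_model_realizing T
    (Set.range fun ij : ℕ × ℕ => orderFormula φ ij.1 ij.2) C (by
      intro s hs
      choose ij hij using fun θ : s => hs θ.2
      -- For each i, one tuple of C satisfies everything that p i decides about the finitely many
      -- parameters a_j occurring in s.
      choose b hb using fun i => exists_realize_of_mem (p i)
        (fun θ : s => if i ≤ (ij θ).2 then inst φ (a (ij θ).2) else (inst φ (a (ij θ).2)).not)
        (fun θ => by
          split_ifs with hle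
          · exact (h _ _).2 hle
          · exact (paramSentence_not_mem_iff _ _).2 fun h' => hle ((h _ _).1 h'))
      refine ⟨Sum.elim (fun x => b x.1 x.2) fun x => a x.1 x.2, fun θ hθ => ?_⟩
      have hθ' := hij ⟨θ, hθ⟩
      dsimp only at hθ'
      rw [← hθ', realize_orderFormula]
      have := hb (ij ⟨θ, hθ⟩).1 ⟨θ, hθ⟩
      split_ifs at this with hle
      · rw [realize_inst] at this
        exact iff_of_true this hle
      · rw [Formula.realize_not, realize_inst] at this
        exact iff_of_false this hle)
  refine fun hst => hst n m φ N
    ⟨fun i k => v (Sum.inl (i, k)), fun j k => v (Sum.inr (j, k)), fun i j => ?_⟩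
  exact (realize_orderFormula φ i j v).1 (hv _ ⟨(i, j), rfl⟩)

/-- Agreement with η about ψ at finitely many types is an open condition for pointwise convergence,
so some translation satisfies it. -/
theorem exists_automorphism_approx {C : Type w} [L.Structure C] {n : ℕ}
    {η : TypeSpace L C n → TypeSpace L C n}
    (hη : η ∈ BetaRank.ellisSemigroup (TypeSpace L C n) (C ≃[L] C))
    (ψ : L[[C]][[Fin n]].Sentence) (s : Finset (TypeSpace L C n)) :
    ∃ σ : C ≃[L] C, ∀ p ∈ s, (ψ ∈ σ • p ↔ ψ ∈ η p) := by
  have hO : IsOpen (⋂ p ∈ s, {g : TypeSpace L C n → TypeSpace L C n | ψ ∈ g p ↔ ψ ∈ η p}) := by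
    refine isOpen_biInter_finset fun p _ => ?_
    have hc := (isClopen_typesWith (M := C) ψ).preimage
      (continuous_apply p : Continuous fun g : TypeSpace L C n → TypeSpace L C n => g p)
    by_cases h : ψ ∈ η p
    · simp only [h, iff_true]
      exact hc.isOpen
    · simp only [h, iff_false]
      exact hc.compl.isOpen
  obtain ⟨_, hg, σ, rfl⟩ := mem_closure_iff.1 hη _ hO (by simp)
  exact ⟨σ, fun p hp => Set.mem_iInter₂.1 hg p hp⟩

/-- Closedness suffices because the complement of a basic set is the basic set of the negation. -/
theorem continuous_iff_isClosed_mem {X : Type*} [TopologicalSpace X] {C : Type w} [L.Structure C]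
    {n : ℕ} (η : X → TypeSpace L C n) :
    Continuous η ↔ ∀ ψ : L[[C]][[Fin n]].Sentence, IsClosed {p | ψ ∈ η p} := by
  refine ⟨fun h ψ => (isClopen_typesWith ψ).isClosed.preimage h, fun h => ?_⟩
  rw [CompleteType.isTopologicalBasis_range_typesWith.continuous_iff]
  rintro _ ⟨ψ, rfl⟩
  rw [← isClosed_compl_iff]
  convert h ψ.not using 1
  ext p
  exact ((η p).not_mem_iff ψ).symm

/-- If the theory is stable, then the elements of the Ellis semigroup are continuous. -/
theorem continuous_of_isStable {T : L.Theory} (hT : IsStable T) {C : Type w} [L.Structure C]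
    [Nonempty C] [C ⊨ T] {n : ℕ} {η : TypeSpace L C n → TypeSpace L C n}
    (hη : η ∈ BetaRank.ellisSemigroup (TypeSpace L C n) (C ≃[L] C)) : Continuous η := by
  classical
  rw [continuous_iff_isClosed_mem]
  intro ψ
  by_contra hD
  obtain ⟨p, hpD, hp⟩ : ∃ p ∈ closure {p | ψ ∈ η p}, ψ ∉ η p := by
    by_contra! hn
    exact hD (isClosed_of_closure_subset hn)
  -- The new type q is taken so close to p that the earlier automorphisms keep ψ out of its
  -- translates, as they do for p. The new σ then imitates η on p, q and all earlier types. The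
  -- condition ψ ∉ σ • p keeps the construction going.
  obtain ⟨f, hf, hr⟩ := exists_seq_of_forall_finset_exists
    (fun x : TypeSpace L C n × (C ≃[L] C) => ψ ∈ η x.1 ∧ ψ ∉ x.2 • p ∧ ψ ∈ x.2 • x.1)
    (fun x y => ψ ∉ x.2 • y.1 ∧ ψ ∈ y.2 • x.1) (by
      intro s hs
      have hO : IsOpen (⋂ x ∈ s, {q : TypeSpace L C n | ψ ∉ x.2 • q}) :=
        isOpen_biInter_finset fun x _ =>
          ((isClopen_typesWith ψ).compl.isOpen).preimage (continuous_const_smul x.2)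
      obtain ⟨q, hqO, hq⟩ := mem_closure_iff.1 hpD _ hO
        (Set.mem_iInter₂.2 fun x hx => (hs x hx).2.1)
      obtain ⟨σ, hσ⟩ := exists_automorphism_approx hη ψ (insert p (insert q (s.image Prod.fst)))
      refine ⟨(q, σ), ⟨hq, ?_, ?_⟩, fun x hx => ⟨Set.mem_iInter₂.1 hqO x hx, ?_⟩⟩
      · rwa [hσ p (by simp)]
      · rwa [hσ q (by simp)]
      · rw [hσ x.1 (by
          simp only [Finset.mem_insert]
          exact Or.inr (Or.inr (Finset.mem_image_of_mem _ hx)))]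
        exact (hs x hx).1)
  obtain ⟨m, φ, a, hφ⟩ := exists_inst ψ
  refine not_isStable_of_types (T := T) φ (fun i => (f i).1) (fun j => (f j).2.symm ∘ a) ?_ hT
  intro i j
  rw [← inst_mem_smul_iff, ← hφ]
  rcases lt_trichotomy i j with h | rfl | h
  · exact iff_of_true (hr i j h).2 h.le
  · exact iff_of_true (hf i).2.2 le_rfl
  · exact iff_of_false (hr j i h).1 h.not_ge

/-- The order property is witnessed by a sequence of parameters all of the same type. -/
theorem exists_order_of_not_isStable {T : L.Theory} (hT : ¬ IsStable T) :
    ∃ (n m : ℕ) (φ : L.Formula (Fin n ⊕ Fin m)) (N : T.ModelType.{u, v, max u v})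
      (b : ℕ → Fin n → N) (a : ℕ → Fin m → N),
      (∀ i j, φ.Realize (Sum.elim (b i) (a j)) ↔ i ≤ j) ∧
      ∀ (ψ : L.Formula (Fin m)) (i : ℕ), ψ.Realize (a i) ↔ ψ.Realize (a 0) := by
  simp only [IsStable, not_forall, not_not] at hT
  obtain ⟨n, m, φ, N, b, a, hba⟩ := hT
  -- U determines a complete limit type of the a_l, and Γ₂ asks every new parameter tuple to have
  -- it. A finite part of Γ₁ ∪ Γ₂ is satisfied along a subsequence inside a U-large set, since
  -- strictly increasing reindexing preserves the order pattern.
  let U : Ultrafilter ℕ := Filter.hyperfilter ℕ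
  let val : (ℕ → ℕ) → (ℕ × Fin n) ⊕ (ℕ × Fin m) → N := fun g =>
    Sum.elim (fun x => b (g x.1) x.2) fun x => a (g x.1) x.2
  let Γ₁ : Set (L.Formula ((ℕ × Fin n) ⊕ (ℕ × Fin m))) :=
    Set.range fun ij : ℕ × ℕ => orderFormula φ ij.1 ij.2
  let copy : ℕ → L.Formula (Fin m) → L.Formula ((ℕ × Fin n) ⊕ (ℕ × Fin m)) := fun i ψ =>
    ψ.relabel fun k => Sum.inr (i, k)
  let Γ₂ : Set (L.Formula ((ℕ × Fin n) ⊕ (ℕ × Fin m))) :=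
    {θ | ∃ (i : ℕ) (ψ : L.Formula (Fin m)), (∀ᶠ l in U, ψ.Realize (a l)) ∧ copy i ψ = θ}
  have hgood : ∀ θ ∈ Γ₁ ∪ Γ₂, ∃ S ∈ U, ∀ g : ℕ → ℕ, StrictMono g → (∀ l, g l ∈ S) →
      θ.Realize (val g) := by
    rintro _ (⟨⟨i, j⟩, rfl⟩ | ⟨i, ψ, hψ, rfl⟩)
    · refine ⟨Set.univ, Filter.univ_mem, fun g hg _ => ?_⟩
      exact (realize_orderFormula φ i j (val g)).2 ((hba _ _).trans hg.le_iff_le)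
    · refine ⟨_, hψ, fun g _ hS => ?_⟩
      rw [Formula.realize_relabel]
      exact hS i
  obtain ⟨N', v, hv⟩ := exists_model_realizing T (Γ₁ ∪ Γ₂) N (by
    intro s hs
    choose S hSU hS using fun θ : s => hgood θ (hs θ.2)
    have hInt : (⋂ θ, S θ) ∈ U := Filter.iInter_mem.2 hSU
    obtain ⟨g, hg, hgS⟩ := Filter.extraction_of_frequently_atTop
      (P := fun l => l ∈ ⋂ θ, S θ)
      ((Filter.Eventually.frequently hInt).filter_mono
        (Nat.hyperfilter_le_atTop))
    exact ⟨val g, fun θ hθ => hS ⟨θ, hθ⟩ g hg fun l => Set.mem_iInter.1 (hgS l) _⟩)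
  refine ⟨n, m, φ, N', fun i k => v (Sum.inl (i, k)), fun j k => v (Sum.inr (j, k)), ?_, ?_⟩
  · intro i j
    exact (realize_orderFormula φ i j v).1 (hv _ (Or.inl ⟨(i, j), rfl⟩))
  · have hcopy : ∀ (ψ : L.Formula (Fin m)) (i : ℕ), (∀ᶠ l in U, ψ.Realize (a l)) →
        ψ.Realize fun k => v (Sum.inr (i, k)) := by
      intro ψ i hψ
      have := hv _ (Or.inr ⟨i, ψ, hψ, rfl⟩)
      rwa [Formula.realize_relabel] at this
    intro ψ i
    -- As U is an ultrafilter, the limit type contains ψ or its negation.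
    by_cases hψ : ∀ᶠ l in U, ψ.Realize (a l)
    · exact iff_of_true (hcopy ψ i hψ) (hcopy ψ 0 hψ)
    · have hψ' : ∀ᶠ l in U, ψ.not.Realize (a l) := by
        simpa only [Formula.realize_not] using Ultrafilter.eventually_not.2 hψ
      exact iff_of_false (Formula.realize_not.1 (hcopy _ i hψ'))
        (Formula.realize_not.1 (hcopy _ 0 hψ'))

/-- If the theory is not stable, then the Ellis semigroup of the action on the types over a monster
model, in suitable variables, has a discontinuous element. -/
theorem exists_not_continuous {T : L.Theory} (hT : T.IsComplete) {C : Type w} [L.Structure C]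
    [Nonempty C] [C ⊨ T] {κ : Cardinal.{w}} (hκ : ℵ₀ ≤ κ) (hsat : IsSaturated L C κ)
    (hhom : IsStronglyHomogeneous L C κ) (hst : ¬ IsStable T) :
    ∃ n : ℕ, ∃ η ∈ BetaRank.ellisSemigroup (TypeSpace L C n) (C ≃[L] C), ¬ Continuous η := by
  obtain ⟨n, m, φ, N, b', a', hba', ha'⟩ := exists_order_of_not_isStable hst
  obtain ⟨d, hd⟩ := realize_countable_family hT hκ hsat
    (Sum.elim (fun x : ℕ × Fin n => b' x.1 x.2) fun x : ℕ × Fin m => a' x.1 x.2)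
  let b : ℕ → Fin n → C := fun i k => d (Sum.inl (i, k))
  let a : ℕ → Fin m → C := fun j k => d (Sum.inr (j, k))
  have hba : ∀ i j, φ.Realize (Sum.elim (b i) (a j)) ↔ i ≤ j := by
    intro i j
    exact (realize_orderFormula φ i j d).1
      ((hd (orderFormula φ i j)).2 ((realize_orderFormula φ i j _).2 (hba' i j)))
  have ha : ∀ (ψ : L.Formula (Fin m)) (i : ℕ), ψ.Realize (a i) ↔ ψ.Realize (a 0) := by
    have h : ∀ (ψ : L.Formula (Fin m)) (i : ℕ), ψ.Realize (a i) ↔ ψ.Realize (a' i) := by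
      intro ψ i
      have := hd (ψ.relabel fun k => Sum.inr (i, k))
      rw [Formula.realize_relabel, Formula.realize_relabel] at this
      exact this
    intro ψ i
    rw [h, h, ha']
  choose σ hσ using fun i => exists_automorphism hκ hhom (a i) (a 0) fun ψ => ha ψ i
  let U : Ultrafilter ℕ := Filter.hyperfilter ℕ
  have hU : ∀ {P : ℕ → Prop} (k : ℕ), (∀ l, k < l → P l) → ∀ᶠ l in U, P l := fun k h =>
    Nat.hyperfilter_le_atTop ((Filter.eventually_gt_atTop k).mono h)
  let t : ℕ → TypeSpace L C n := fun i => tupleType (b i)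
  -- Both limits exist by compactness, of the type space and of its power.
  obtain ⟨p, -, hp⟩ := isCompact_univ.ultrafilter_le_nhds (U.map t) (by simp)
  let F : ℕ → TypeSpace L C n → TypeSpace L C n := fun i q => σ i • q
  obtain ⟨η, -, hη⟩ := isCompact_univ.ultrafilter_le_nhds (U.map F) (by simp)
  have hη' : Filter.Tendsto F U (𝓝 η) := hη
  have hp' : Filter.Tendsto t U (𝓝 p) := hp
  have hmem : ∀ (ψ : L[[C]][[Fin n]].Sentence) (q : TypeSpace L C n),
      (∀ᶠ i in U, ψ ∈ σ i • q) → ψ ∈ η q := by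
    intro ψ q h
    exact (isClopen_typesWith ψ).isClosed.mem_of_tendsto (tendsto_pi_nhds.1 hη' q) h
  have hσ' : ∀ i, (σ i).symm ∘ a 0 = a i := by
    intro i
    rw [← hσ i]
    exact funext fun k => (σ i).symm_apply_apply _
  -- With i fixed and j tending to infinity, φ(b_i, a_j) is eventually true.
  have hin : ∀ i, paramSentence (inst φ (a 0)) ∈ η (t i) := by
    refine fun i => hmem _ _ (hU i fun j hij => ?_)
    rw [inst_mem_smul_iff, hσ', paramSentence_mem_tupleType, realize_inst]
    exact (hba i j).2 hij.le
  -- The other order of limits: with j fixed, φ(b_i, a_j) fails for all i > j, so the negation of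
  -- φ(x, a_j) is in p for every j.
  have hout : paramSentence (inst φ (a 0)) ∉ η p := by
    rw [← Theory.CompleteType.not_mem_iff]
    refine hmem _ _ (Filter.Eventually.of_forall fun j => ?_)
    rw [Theory.CompleteType.not_mem_iff, inst_mem_smul_iff, hσ', ← Theory.CompleteType.not_mem_iff]
    refine (isClopen_typesWith _).isClosed.mem_of_tendsto hp' (hU j fun i hij => ?_)
    change _ ∈ t i
    rw [Theory.CompleteType.not_mem_iff, paramSentence_mem_tupleType, realize_inst]
    exact fun h => hij.not_ge ((hba i j).1 h)
  refine ⟨n, η, mem_closure_of_tendsto hη' (Filter.Eventually.of_forall fun i => ⟨σ i, rfl⟩), ?_⟩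
  intro hcont
  exact hout ((((continuous_iff_isClosed_mem η).1 hcont _).mem_of_tendsto hp'
    (Filter.Eventually.of_forall hin)))

end ModelTh

theorem mainTheorem2 {L : FirstOrder.Language.{u, v}} (T : L.Theory) (hT : T.IsComplete)
    (C : Type w) [L.Structure C] [Nonempty C] (hC : C ⊨ T) (hmonster : ModelTh.IsMonster L C) :
    (ModelTh.IsStable T ↔
      ∀ n : ℕ, BetaRank.rank (ModelTh.TypeSpace L C n) (C ≃[L] C) = 0) ∧
    (ModelTh.IsStable T ↔
      ∀ n : ℕ, ∀ η ∈ BetaRank.ellisSemigroup (ModelTh.TypeSpace L C n) (C ≃[L] C),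
        Continuous η) := by
  have hcont : ModelTh.IsStable T ↔
      ∀ n : ℕ, ∀ η ∈ BetaRank.ellisSemigroup (ModelTh.TypeSpace L C n) (C ≃[L] C),
        Continuous η := by
    refine ⟨fun h n η hη => ModelTh.continuous_of_isStable h hη, fun h => ?_⟩
    by_contra hst
    obtain ⟨κ, hκ, hsat, hhom⟩ := hmonster
    have hκ' : ℵ₀ ≤ κ := by
      have := ((Cardinal.lift_le.2 (le_max_left ℵ₀ L.card)).trans hκ.le)
      rwa [Cardinal.lift_aleph0, Cardinal.aleph0_le_lift] at this
    obtain ⟨n, η, hη, hn⟩ := ModelTh.exists_not_continuous hT hκ' hsat hhom hst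
    exact hn (h n η hη)
  refine ⟨?_, hcont⟩
  simp only [BetaRank.rank_eq_zero_iff]
  exact hcont
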